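/- Let $n\ge 1$ be an integer, $\lambda>0$ and $0<\gamma_m<2$. Consider a flat FLRW cosmology (units $c=8\pi G=1$) with a scalar field $\phi$ with potential $V(\phi)=\frac{1}{2n}(\lambda\phi)^{2n}$ and a perfect fluid with energy density $\rho_m\ge 0$ and pressure $p_m=(\gamma_m-1)\rho_m$; that is, a solution, with Hubble variable $H>0$, on an open interval of proper time $t$, of $$3H^2=\rho_\phi+\rho_m,\qquad \dot H=-\tfrac12\bigl(\dot\phi^2+\gamma_m\rho_m\bigr),\qquad \ddot\phi+3H\dot\phi+\lambda^{2n}\phi^{2n-1}=0,\qquad \dot\rho_m=-3H\gamma_m\rho_m,$$ where $\rho_\phi=\tfrac12\dot\phi^2+V(\phi)$. Suppose that the solution cannot be extended to later times and that $\rho_\phi\rho_m>0$ at some time. Then the solution exists for all later times, and the ratio $r=\rho_\phi/\rho_m$ behaves as follows as $t\to\infty$: (i) if $\gamma_m>\frac{2n}{n+1}$, then $r\to\infty$, i.e. the solution is future asymptotically scalar-field dominated; (ii) if $\gamma_m<\frac{2n}{n+1}$, then $r\to 0$, i.e. the solution is future asymptotically perfect-fluid dominated; (iii) if $\gamma_m=\frac{2n}{n+1}$,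 then $r$ tends to a constant $c$ with $0<c<\infty$ (depending on the solution), so there is neither scalar-field nor perfect-fluid dominance in the future. -/

import Mathlib

/-!
Flat Friedmann-Lemaitre-Robertson-Walker cosmology with a minimally coupled scalar field with
monomial potential and a perfect fluid with linear equation of state, in units `c = 8πG = 1`.
-/

namespace FlatFLRW

/-- The monomial potential `V(x) = (λ x)^(2n) / (2n)`. -/
noncomputable def potential (n : ℕ) (lam x : ℝ) : ℝ :=
  (lam * x) ^ (2 * n) / (2 * (n : ℝ))

/-- The time-dependent quantities of the model, as functions of synchronous proper time `t`:
the scalar field `φ`, its time derivative `φ̇`, the Hubble variable `H`, and the energy density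
`ρ_m` of the perfect fluid. -/
structure Fields where
  phi : ℝ → ℝ
  phiDot : ℝ → ℝ
  hubble : ℝ → ℝ
  rhoM : ℝ → ℝ

/-- The energy density of the scalar field, `ρ_φ = φ̇² / 2 + V(φ)`. -/
noncomputable def Fields.rhoPhi (F : Fields) (n : ℕ) (lam t : ℝ) : ℝ :=
  F.phiDot t ^ 2 / 2 + potential n lam (F.phi t)

/-- The ratio `r = ρ_φ / ρ_m`. -/
noncomputable def Fields.ratio (F : Fields) (n : ℕ) (lam t : ℝ) : ℝ :=
  F.rhoPhi n lam t / F.rhoM t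

/-- `F` is a solution, on the nonempty open interval `I`, of the Einstein and matter field
equations with parameters `n`, `λ` and adiabatic index `γ_m` (written `gam`), for an expanding
universe and a fluid of nonnegative energy density. -/
structure IsSolutionOn (n : ℕ) (lam gam : ℝ) (F : Fields) (I : Set ℝ) : Prop where
  isOpen : IsOpen I
  ordConnected : I.OrdConnected
  nonempty : I.Nonempty
  /-- The universe is expanding. -/
  hubble_pos : ∀ t ∈ I, 0 < F.hubble t
  rhoM_nonneg : ∀ t ∈ I, 0 ≤ F.rhoM t
  /-- The Gauss constraint `3 H² = ρ_φ + ρ_m`. -/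
  gauss : ∀ t ∈ I, 3 * F.hubble t ^ 2 = F.rhoPhi n lam t + F.rhoM t
  /-- The Raychaudhuri equation `Ḣ = -(φ̇² + γ_m ρ_m) / 2`. -/
  raychaudhuri : ∀ t ∈ I,
    HasDerivAt F.hubble (-(F.phiDot t ^ 2 + gam * F.rhoM t) / 2) t
  hasDerivAt_phi : ∀ t ∈ I, HasDerivAt F.phi (F.phiDot t) t
  /-- The Klein-Gordon equation `φ̈ + 3 H φ̇ + λ^(2n) φ^(2n-1) = 0`. -/
  kleinGordon : ∀ t ∈ I, HasDerivAt F.phiDot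
    (-(3 * F.hubble t * F.phiDot t) - lam ^ (2 * n) * F.phi t ^ (2 * n - 1)) t
  /-- The fluid equation `ρ̇_m = -3 H γ_m ρ_m`. -/
  fluid : ∀ t ∈ I, HasDerivAt F.rhoM (-(3 * F.hubble t * gam * F.rhoM t)) t

/-- `F` is a solution on `I` that cannot be continued toward the future: no solution that
extends it is defined at a time later than all times in `I`. -/
structure IsFutureMaximalSolutionOn (n : ℕ) (lam gam : ℝ) (F : Fields) (I : Set ℝ) : Prop where
  isSolutionOn : IsSolutionOn n lam gam F I
  maximal : ∀ (G : Fields) (J : Set ℝ), IsSolutionOn n lam gam G J → I ⊆ J →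
    Set.EqOn G.phi F.phi I → Set.EqOn G.phiDot F.phiDot I →
    Set.EqOn G.hubble F.hubble I → Set.EqOn G.rhoM F.rhoM I →
    ∀ s ∈ J, ∃ t ∈ I, s ≤ t

end FlatFLRW

/-! The Hubble rate drives both logarithms: `log ρ_m` has derivative `-3γ_m H`, while `log ρ_φ` has
derivative `-3H φ̇²/ρ_φ`, which oscillates. By the virial theorem for a potential of degree `2n`,
`φ̇²/ρ_φ` averages to `2n/(n+1)`, so `log r` should drift at rate `3H(γ_m - 2n/(n+1))`, whose sign
decides the three cases.

No averaging over periods is needed. With `w = Hφφ̇/ρ_φ`, the corrected quantity `L = log r +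
3w/(n+1)` has exactly this drift plus an error of size at most `9H|w|`
(`hasDerivAt_averagedLogRatio`). By the Gauss constraint `w² ≤ φ²(1 + 1/r)` (`sq_virial_le`), and `φ
→ 0` because `ρ_φ → 0` (`tendsto_rhoPhi`). Since `ρ_m → 0`, `-log ρ_m` serves as a clock that runs
to infinity and against which `L` is compared.

If `γ_m ≥ 2n/(n+1)`, then `w → 0` outright (`exists_sq_virial_le`), and at equality `w` is bounded
by a power of `ρ_m`, so the error is integrable and `L` converges. If `γ_m < 2n/(n+1)`, then `w` is
only known to be small while `r` stays away from zero; this still forces `r` below every level and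
keeps it there.

Global existence is a continuation argument: up to a finite end time a solution with fluid stays in
a compact subset of `{H > 0, ρ_m > 0}`. -/

open Set Filter Topology

/-! ### Monotonicity and Grönwall-type lemmas on the line. -/

section Calculus

theorem antitoneOn_of_hasDerivAt_nonpos {D : Set ℝ} (hD : Convex ℝ D) {f f' : ℝ → ℝ}
    (hf : ∀ t ∈ D, HasDerivAt f (f' t) t) (hf' : ∀ t ∈ D, f' t ≤ 0) : AntitoneOn f D :=
  antitoneOn_of_hasDerivWithinAt_nonpos hD
    (fun t ht => (hf t ht).continuousAt.continuousWithinAt)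
    (fun t ht => (hf t (interior_subset ht)).hasDerivWithinAt)
    (fun t ht => hf' t (interior_subset ht))

theorem monotoneOn_of_hasDerivAt_nonneg {D : Set ℝ} (hD : Convex ℝ D) {f f' : ℝ → ℝ}
    (hf : ∀ t ∈ D, HasDerivAt f (f' t) t) (hf' : ∀ t ∈ D, 0 ≤ f' t) : MonotoneOn f D :=
  monotoneOn_of_hasDerivWithinAt_nonneg hD
    (fun t ht => (hf t ht).continuousAt.continuousWithinAt)
    (fun t ht => (hf t (interior_subset ht)).hasDerivWithinAt)
    (fun t ht => hf' t (interior_subset ht))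

/-- A lower Grönwall inequality: `f' ≥ -K f` forces `f` to decay at most exponentially. -/
theorem mul_exp_le_of_hasDerivAt {a b K : ℝ} (hab : a ≤ b) {f f' : ℝ → ℝ}
    (hf : ∀ t ∈ Icc a b, HasDerivAt f (f' t) t) (hf' : ∀ t ∈ Icc a b, -(K * f t) ≤ f' t) :
    f a * Real.exp (-(K * (b - a))) ≤ f b := by
  have hmono := monotoneOn_of_hasDerivAt_nonneg (convex_Icc a b)
    (f := fun t => f t * Real.exp (K * (t - a)))
    (f' := fun t => f' t * Real.exp (K * (t - a)) + f t * (Real.exp (K * (t - a)) * (K * 1)))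
    (fun t ht => (hf t ht).mul ((((hasDerivAt_id t).sub_const a).const_mul K).exp))
    (fun t ht => by
      have h1 := hf' t ht
      have h2 := Real.exp_pos (K * (t - a))
      have : 0 ≤ (f' t + K * f t) * Real.exp (K * (t - a)) :=
        mul_nonneg (by linarith) h2.le
      nlinarith)
  have h := hmono (left_mem_Icc.2 hab) (right_mem_Icc.2 hab) hab
  simp only [sub_self, mul_zero, Real.exp_zero, mul_one] at h
  rw [Real.exp_neg, ← div_eq_mul_inv, div_le_iff₀ (Real.exp_pos _)]
  exact h

theorem exists_lt_of_hasDerivAt_le {a c : ℝ} (hc : 0 < c) {f f' : ℝ → ℝ}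
    (hf : ∀ t ≥ a, HasDerivAt f (f' t) t) (hf' : ∀ t ≥ a, f' t ≤ -c) (B : ℝ) :
    ∃ t ≥ a, f t < B := by
  have hanti := antitoneOn_of_hasDerivAt_nonpos (convex_Ici a)
    (f := fun t => f t + c * t) (f' := fun t => f' t + c * 1)
    (fun t ht => (hf t ht).add ((hasDerivAt_id t).const_mul c))
    (fun t ht => by have := hf' t ht; linarith)
  set t := a + (|f a - B| + 1) / c with ht
  have hat : a ≤ t := by
    have : 0 ≤ (|f a - B| + 1) / c := by positivity
    linarith
  refine ⟨t, hat, ?_⟩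
  have h := hanti (mem_Ici.2 le_rfl) (mem_Ici.2 hat) hat
  have h1 : c * t = c * a + (|f a - B| + 1) := by
    rw [ht]; field_simp
  have h2 := le_abs_self (f a - B)
  simp only at h
  linarith

theorem tendsto_zero_of_antitoneOn {a : ℝ} {f : ℝ → ℝ} (hf : AntitoneOn f (Ici a))
    (h0 : ∀ t ≥ a, 0 ≤ f t) (hsmall : ∀ ε > 0, ∃ t ≥ a, f t < ε) :
    Tendsto f atTop (𝓝 0) := by
  rw [Metric.tendsto_atTop]
  intro ε hε
  obtain ⟨t, hta, ht⟩ := hsmall ε hε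
  refine ⟨t, fun s hs => ?_⟩
  have hsa : a ≤ s := le_trans hta hs
  rw [Real.dist_eq, sub_zero, abs_of_nonneg (h0 s hsa)]
  exact (hf hta hsa hs).trans_lt ht

/-- A function trapped between a monotone function and its perturbation by a bounded antitone
function converges. -/
theorem exists_tendsto_of_monotoneOn_sub_of_antitoneOn_add {a : ℝ} {f g : ℝ → ℝ}
    (h1 : MonotoneOn (fun t => f t - g t) (Ici a)) (h2 : AntitoneOn (fun t => f t + g t) (Ici a))
    (hg0 : ∀ t ≥ a, 0 ≤ g t) (hg : Tendsto g atTop (𝓝 0)) :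
    ∃ l, Tendsto f atTop (𝓝 l) := by
  -- Composing with `max a` freezes the function to the left of `a`, giving a function monotone on
  -- the whole line.
  have hmono : Monotone (fun t => f (max a t) - g (max a t)) := fun s t hst =>
    h1 (mem_Ici.2 (le_max_left _ _)) (mem_Ici.2 (le_max_left _ _)) (max_le_max le_rfl hst)
  have hbdd : BddAbove (range fun t => f (max a t) - g (max a t)) := by
    refine ⟨f a + g a, ?_⟩
    rintro _ ⟨t, rfl⟩
    have h3 := h2 (mem_Ici.2 le_rfl) (mem_Ici.2 (le_max_left a t)) (le_max_left a t)
    have h4 := hg0 _ (le_max_left a t)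
    simp only at h3 ⊢
    linarith
  refine ⟨⨆ t, (f (max a t) - g (max a t)), ?_⟩
  have h := (tendsto_atTop_ciSup hmono hbdd).add hg
  rw [add_zero] at h
  refine h.congr' ?_
  filter_upwards [eventually_ge_atTop a] with t ht
  rw [max_eq_right ht]; ring

end Calculus

/-! ### Energy estimates and decay of both densities. -/

namespace FlatFLRW

variable {n : ℕ} {lam gam : ℝ} {F : Fields} {I : Set ℝ}

theorem potential_nonneg (n : ℕ) (lam x : ℝ) : 0 ≤ potential n lam x :=
  div_nonneg ((even_two_mul n).pow_nonneg _) (by positivity)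

theorem hasDerivAt_potential (hn : 1 ≤ n) (lam x : ℝ) :
    HasDerivAt (potential n lam) (lam ^ (2 * n) * x ^ (2 * n - 1)) x := by
  have h := (((hasDerivAt_id x).const_mul lam).pow (2 * n)).div_const (2 * (n : ℝ))
  have hn0 : (n : ℝ) ≠ 0 := by positivity
  refine HasDerivAt.congr_deriv (f := potential n lam) h ?_
  have hp : lam ^ (2 * n) = lam * lam ^ (2 * n - 1) := by
    rw [← pow_succ']; congr 1; omega
  rw [hp, id, mul_pow]
  push_cast
  field_simp

/-- Euler's identity for a homogeneous function of degree `2n`; this is where the critical index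
`2n/(n+1)` comes from. -/
theorem mul_potential_eq (hn : 1 ≤ n) (lam x : ℝ) :
    lam ^ (2 * n) * x ^ (2 * n - 1) * x = 2 * n * potential n lam x := by
  have hn0 : (n : ℝ) ≠ 0 := by positivity
  rw [potential, mul_assoc, ← pow_succ, mul_pow]
  have : 2 * n - 1 + 1 = 2 * n := by omega
  rw [this]; field_simp

theorem Fields.sq_phiDot_le (F : Fields) (n : ℕ) (lam t : ℝ) :
    F.phiDot t ^ 2 ≤ 2 * F.rhoPhi n lam t := by
  have := potential_nonneg n lam (F.phi t)
  rw [Fields.rhoPhi]; linarith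

theorem Fields.rhoPhi_nonneg (F : Fields) (n : ℕ) (lam t : ℝ) : 0 ≤ F.rhoPhi n lam t := by
  have := F.sq_phiDot_le n lam t
  nlinarith [sq_nonneg (F.phiDot t)]

/-- The field amplitude is controlled by a root of its energy density. -/
theorem Fields.sq_phi_le (hn : 1 ≤ n) (hlam : 0 < lam) (F : Fields) (t : ℝ) :
    F.phi t ^ 2 ≤
      (2 * n : ℝ) ^ (n : ℝ)⁻¹ / lam ^ 2 * F.rhoPhi n lam t ^ (n : ℝ)⁻¹ := by
  have hn0 : (0 : ℝ) < n := by positivity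
  have h1 : ((lam * F.phi t) ^ 2) ^ n ≤ 2 * n * F.rhoPhi n lam t := by
    rw [← pow_mul, Fields.rhoPhi, potential]
    have : (lam * F.phi t) ^ (2 * n) =
      2 * n * ((lam * F.phi t) ^ (2 * n) / (2 * n)) := by field_simp
    nlinarith [sq_nonneg (F.phiDot t)]
  have h2 := Real.rpow_le_rpow (by positivity) h1 (inv_nonneg.2 hn0.le)
  rw [Real.pow_rpow_inv_natCast (sq_nonneg _) (by omega),
    Real.mul_rpow (by positivity) (F.rhoPhi_nonneg n lam t), mul_pow] at h2
  rw [div_mul_eq_mul_div, le_div_iff₀ (by positivity)]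
  linarith

namespace IsSolutionOn

theorem convex (h : IsSolutionOn n lam gam F I) : Convex ℝ I := h.ordConnected.convex

theorem hasDerivAt_rhoPhi (hn : 1 ≤ n) (h : IsSolutionOn n lam gam F I) {t : ℝ} (ht : t ∈ I) :
    HasDerivAt (F.rhoPhi n lam) (-(3 * F.hubble t * F.phiDot t ^ 2)) t := by
  have h1 := (((h.kleinGordon t ht).pow 2).div_const 2).add
    ((hasDerivAt_potential hn lam (F.phi t)).comp t (h.hasDerivAt_phi t ht))
  refine HasDerivAt.congr_deriv (f := F.rhoPhi n lam) h1 ?_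
  push_cast; ring

theorem raychaudhuri_nonpos (hgam : 0 < gam) (h : IsSolutionOn n lam gam F I) {t : ℝ}
    (ht : t ∈ I) : -(F.phiDot t ^ 2 + gam * F.rhoM t) / 2 ≤ 0 := by
  have := mul_nonneg hgam.le (h.rhoM_nonneg t ht)
  nlinarith [sq_nonneg (F.phiDot t)]

theorem antitoneOn_hubble (hgam : 0 < gam) (h : IsSolutionOn n lam gam F I) :
    AntitoneOn F.hubble I :=
  antitoneOn_of_hasDerivAt_nonpos h.convex h.raychaudhuri
    fun _ ht => h.raychaudhuri_nonpos hgam ht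

theorem antitoneOn_rhoM (hgam : 0 < gam) (h : IsSolutionOn n lam gam F I) :
    AntitoneOn F.rhoM I :=
  antitoneOn_of_hasDerivAt_nonpos h.convex h.fluid fun t ht => by
    have h1 := h.hubble_pos t ht
    have h2 := h.rhoM_nonneg t ht
    have : 0 ≤ 3 * F.hubble t * gam * F.rhoM t := by positivity
    linarith

theorem antitoneOn_rhoPhi (hn : 1 ≤ n) (h : IsSolutionOn n lam gam F I) :
    AntitoneOn (F.rhoPhi n lam) I :=
  antitoneOn_of_hasDerivAt_nonpos h.convex (fun _ ht => h.hasDerivAt_rhoPhi hn ht)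
    fun t ht => by
      have h1 := h.hubble_pos t ht
      have : 0 ≤ 3 * F.hubble t * F.phiDot t ^ 2 := by positivity
      linarith

theorem rhoM_lower_bound (hgam : 0 < gam) (h : IsSolutionOn n lam gam F I) {a t : ℝ}
    (ha : a ∈ I) (ht : t ∈ I) (hat : a ≤ t) :
    F.rhoM a * Real.exp (-(3 * F.hubble a * gam * (t - a))) ≤ F.rhoM t := by
  have hsub := h.ordConnected.out ha ht
  refine mul_exp_le_of_hasDerivAt hat (fun s hs => h.fluid s (hsub hs)) fun s hs => ?_
  have h1 := h.antitoneOn_hubble hgam ha (hsub hs) hs.1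
  have h2 := h.rhoM_nonneg s (hsub hs)
  have : 0 ≤ 3 * (F.hubble a - F.hubble s) * (gam * F.rhoM s) :=
    mul_nonneg (by linarith) (mul_nonneg hgam.le h2)
  linarith

/-- The rate 6 is the worst case `φ̇² = 2ρ_φ` of purely kinetic energy. The bound keeps `ρ_φ`
positive, so that its logarithm makes sense. -/
theorem rhoPhi_lower_bound (hn : 1 ≤ n) (hgam : 0 < gam) (h : IsSolutionOn n lam gam F I)
    {a t : ℝ} (ha : a ∈ I) (ht : t ∈ I) (hat : a ≤ t) :
    F.rhoPhi n lam a * Real.exp (-(6 * F.hubble a * (t - a))) ≤ F.rhoPhi n lam t := by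
  have hsub := h.ordConnected.out ha ht
  refine mul_exp_le_of_hasDerivAt hat (fun s hs => h.hasDerivAt_rhoPhi hn (hsub hs))
    fun s hs => ?_
  have h1 := h.antitoneOn_hubble hgam ha (hsub hs) hs.1
  have h2 := F.sq_phiDot_le n lam s
  have h3 := h.hubble_pos s (hsub hs)
  have h4 := F.rhoPhi_nonneg n lam s
  have : 0 ≤ F.hubble s * (2 * F.rhoPhi n lam s - F.phiDot s ^ 2) :=
    mul_nonneg h3.le (by linarith)
  have : 0 ≤ (F.hubble a - F.hubble s) * F.rhoPhi n lam s := mul_nonneg (by linarith) h4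
  nlinarith

section Decay

variable {a : ℝ}

theorem tendsto_rhoM (hgam : 0 < gam) (h : IsSolutionOn n lam gam F I) (ha : Ici a ⊆ I) :
    Tendsto F.rhoM atTop (𝓝 0) := by
  refine tendsto_zero_of_antitoneOn ((h.antitoneOn_rhoM hgam).mono ha)
    (fun t ht => h.rhoM_nonneg t (ha ht)) fun ε hε => ?_
  by_contra! hcon
  -- If `ρ_m ≥ ε` forever, the Gauss constraint bounds `H` below by `√(ε/3)`, and `ρ_m` would
  -- decrease at least linearly, hence become negative.
  obtain ⟨t, hta, ht⟩ := exists_lt_of_hasDerivAt_le (a := a)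
    (c := 3 * √(ε / 3) * gam * ε) (by positivity)
    (fun t ht => h.fluid t (ha ht)) (fun t ht => by
      have h1 := h.gauss t (ha ht)
      have h2 := F.rhoPhi_nonneg n lam t
      have h3 := hcon t ht
      have h4 : √(ε / 3) ≤ F.hubble t :=
        Real.sqrt_le_iff.2 ⟨(h.hubble_pos t (ha ht)).le, by linarith⟩
      have h5 := (h.hubble_pos t (ha ht)).le
      have : 3 * √(ε / 3) * gam * ε ≤ 3 * F.hubble t * gam * F.rhoM t := by gcongr
      linarith) 0
  exact absurd (h.rhoM_nonneg t (ha hta)) (not_le.2 ht)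

/-- The scalar field energy decays: the virial functional `φ φ̇ + 3/2 H φ² + 2 (n + 1) H` loses at
least `2 n ρ_φ` per unit of time, but is bounded below. -/
theorem tendsto_rhoPhi (hn : 1 ≤ n) (hlam : 0 < lam) (hgam : 0 < gam)
    (h : IsSolutionOn n lam gam F I) (ha : Ici a ⊆ I) :
    Tendsto (F.rhoPhi n lam) atTop (𝓝 0) := by
  refine tendsto_zero_of_antitoneOn ((h.antitoneOn_rhoPhi hn).mono ha)
    (fun t _ => F.rhoPhi_nonneg n lam t) fun ε hε => ?_
  by_contra! hcon
  have hn1 : (1 : ℝ) ≤ n := by exact_mod_cast hn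
  -- The term `3/2 H φ²` cancels the friction term `-3Hφφ̇`, and `2(n+1)H` turns `+φ̇²` into
  -- `-nφ̇²`; what remains is at most `-2nρ_φ`.
  have hderiv : ∀ t ≥ a, HasDerivAt
      (fun t => F.phi t * F.phiDot t + 3 / 2 * (F.hubble t * F.phi t ^ 2)
        + 2 * (n + 1) * F.hubble t) _ t := fun t ht =>
    (((h.hasDerivAt_phi t (ha ht)).mul (h.kleinGordon t (ha ht))).add
      (((h.raychaudhuri t (ha ht)).mul ((h.hasDerivAt_phi t (ha ht)).pow 2)).const_mul
        (3 / 2))).add ((h.raychaudhuri t (ha ht)).const_mul (2 * (n + 1 : ℝ)))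
  set K := (2 * n : ℝ) ^ (n : ℝ)⁻¹ / lam ^ 2 * F.rhoPhi n lam a ^ (n : ℝ)⁻¹ with hK
  obtain ⟨t, hta, ht⟩ := exists_lt_of_hasDerivAt_le (a := a) (c := 2 * ε) (by positivity)
    hderiv (fun t ht => by
      have h1 := mul_potential_eq hn lam (F.phi t)
      have h2 := h.raychaudhuri_nonpos hgam (ha ht)
      have h3 : 0 ≤ gam * F.rhoM t := mul_nonneg hgam.le (h.rhoM_nonneg t (ha ht))
      have h4 := hcon t ht
      have h5 : -(F.phiDot t ^ 2 + gam * F.rhoM t) / 2 * F.phi t ^ 2 ≤ 0 :=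
        mul_nonpos_of_nonpos_of_nonneg h2 (sq_nonneg _)
      have h6 : F.rhoPhi n lam t = F.phiDot t ^ 2 / 2 + potential n lam (F.phi t) := rfl
      have h7 : ε ≤ n * F.rhoPhi n lam t := by nlinarith
      have h8 : 0 ≤ (n : ℝ) * (gam * F.rhoM t) := by positivity
      simp only [Nat.cast_ofNat, Pi.pow_apply]
      rw [h6] at h7
      nlinarith) (-(K + 2 * F.rhoPhi n lam a) / 2)
  have h1 := F.sq_phi_le hn hlam t
  have h2 := F.sq_phiDot_le n lam t
  have h3 := h.antitoneOn_rhoPhi hn (ha (mem_Ici.2 le_rfl)) (ha hta) hta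
  have h4 : F.rhoPhi n lam t ^ (n : ℝ)⁻¹ ≤ F.rhoPhi n lam a ^ (n : ℝ)⁻¹ :=
    Real.rpow_le_rpow (F.rhoPhi_nonneg n lam t) h3 (by positivity)
  have h5 : F.phi t ^ 2 ≤ K := h1.trans (by rw [hK]; gcongr)
  have h6 := (h.hubble_pos t (ha hta)).le
  have h7 : 0 ≤ 3 / 2 * (F.hubble t * F.phi t ^ 2) := by positivity
  have h8 : 0 ≤ 2 * (n + 1) * F.hubble t := by positivity
  nlinarith [sq_nonneg (F.phi t + F.phiDot t)]

end Decay

end IsSolutionOn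

/-! ### The corrected logarithm of the density ratio. -/

/-- The virial term `H φ φ̇ / ρ_φ`, whose derivative compensates the oscillating part of the
logarithmic decay rate of `ρ_φ`. -/
noncomputable def Fields.virial (F : Fields) (n : ℕ) (lam t : ℝ) : ℝ :=
  F.hubble t * (F.phi t * F.phiDot t) / F.rhoPhi n lam t

/-- The logarithm of `ρ_φ / ρ_m`, corrected by the virial term. -/
noncomputable def Fields.averagedLogRatio (F : Fields) (n : ℕ) (lam t : ℝ) : ℝ :=
  Real.log (F.rhoPhi n lam t) - Real.log (F.rhoM t) + 3 / (n + 1) * F.virial n lam t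

namespace IsSolutionOn

theorem hasDerivAt_log_rhoM (h : IsSolutionOn n lam gam F I) {t : ℝ} (ht : t ∈ I)
    (hrho : 0 < F.rhoM t) :
    HasDerivAt (fun t => Real.log (F.rhoM t)) (-(3 * gam * F.hubble t)) t := by
  convert (h.fluid t ht).log hrho.ne' using 1
  field_simp

/-- Along solutions `(φφ̇)˙ = (n+1)φ̇² - 2nρ_φ - 3Hφφ̇`, so adding `3w/(n+1)` replaces `φ̇²/ρ_φ` by
its mean `2n/(n+1)`. The rest is proportional to `w`. -/
theorem hasDerivAt_averagedLogRatio (hn : 1 ≤ n) (hgam : 0 < gam) (hgam2 : gam < 2)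
    (h : IsSolutionOn n lam gam F I) {t : ℝ} (ht : t ∈ I)
    (hphi : 0 < F.rhoPhi n lam t) (hrho : 0 < F.rhoM t) :
    ∃ e, |e| ≤ 9 * F.hubble t * |F.virial n lam t| ∧
      HasDerivAt (F.averagedLogRatio n lam)
        (3 * F.hubble t * (gam - 2 * n / (n + 1)) + e) t := by
  have hH := h.hubble_pos t ht
  have hn1 : (1 : ℝ) ≤ n := by exact_mod_cast hn
  have hE := h.hasDerivAt_rhoPhi hn ht
  have hw := ((h.raychaudhuri t ht).mul
    ((h.hasDerivAt_phi t ht).mul (h.kleinGordon t ht))).div hE hphi.ne'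
  have hL := ((hE.log hphi.ne').sub (h.hasDerivAt_log_rhoM ht hrho)).add
    (hw.const_mul (3 / (n + 1 : ℝ)))
  -- The factor multiplying `w` in `ẇ`: contributions from `Ḣ/H`, from `-ρ̇_φ/ρ_φ` and from
  -- friction, each of order `H`.
  set B := -(F.phiDot t ^ 2 + gam * F.rhoM t) / 2 / F.hubble t
    + 3 * F.hubble t * F.phiDot t ^ 2 / F.rhoPhi n lam t - 3 * F.hubble t with hB
  refine ⟨3 / (n + 1) * F.virial n lam t * B, ?_, ?_⟩
  · have hB6 : |B| ≤ 6 * F.hubble t := by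
      have h1 : -(F.phiDot t ^ 2 + gam * F.rhoM t) / 2 / F.hubble t ≤ 0 :=
        div_nonpos_of_nonpos_of_nonneg (h.raychaudhuri_nonpos hgam ht) hH.le
      -- Since `γ_m < 2`, `φ̇² + γ_m ρ_m ≤ 2(ρ_φ + ρ_m) = 6H²`.
      have h2 : -(3 * F.hubble t) ≤ -(F.phiDot t ^ 2 + gam * F.rhoM t) / 2 / F.hubble t := by
        rw [le_div_iff₀ hH]
        nlinarith [h.gauss t ht, F.sq_phiDot_le n lam t]
      have h3 : 0 ≤ 3 * F.hubble t * F.phiDot t ^ 2 / F.rhoPhi n lam t := by positivity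
      have h4 : 3 * F.hubble t * F.phiDot t ^ 2 / F.rhoPhi n lam t ≤ 6 * F.hubble t := by
        rw [div_le_iff₀ hphi]
        nlinarith [F.sq_phiDot_le n lam t]
      rw [abs_le]
      constructor <;> linarith
    have hk : |3 / (n + 1 : ℝ)| ≤ 3 / 2 := by
      rw [abs_of_nonneg (by positivity)]
      gcongr; linarith
    rw [abs_mul, abs_mul]
    calc |3 / (n + 1 : ℝ)| * |F.virial n lam t| * |B|
        ≤ 3 / 2 * |F.virial n lam t| * (6 * F.hubble t) := by gcongr
      _ = _ := by ring
  · refine hL.congr_deriv ?_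
    have h1 := mul_potential_eq hn lam (F.phi t)
    have h2 : potential n lam (F.phi t) = F.rhoPhi n lam t - F.phiDot t ^ 2 / 2 := by
      rw [Fields.rhoPhi]; ring
    rw [h2] at h1
    have h3 : F.phi t * (-(3 * F.hubble t * F.phiDot t) - lam ^ (2 * n) * F.phi t ^ (2 * n - 1))
        = -(3 * F.hubble t * (F.phi t * F.phiDot t))
          - 2 * n * (F.rhoPhi n lam t - F.phiDot t ^ 2 / 2) := by
      linarith
    simp only [Pi.mul_apply]
    rw [h3, hB, Fields.virial]
    field_simp
    ring

theorem sq_virial_le (h : IsSolutionOn n lam gam F I) {t : ℝ} (ht : t ∈ I)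
    (hphi : 0 < F.rhoPhi n lam t) :
    F.virial n lam t ^ 2 ≤ F.phi t ^ 2 * (1 + F.rhoM t / F.rhoPhi n lam t) := by
  have h1 := h.gauss t ht
  have h2 := F.sq_phiDot_le n lam t
  have h3 := h.rhoM_nonneg t ht
  have h4 : F.virial n lam t ^ 2 = (F.rhoPhi n lam t + F.rhoM t) / 3 * F.phi t ^ 2 *
      F.phiDot t ^ 2 / F.rhoPhi n lam t ^ 2 := by
    rw [← h1, Fields.virial]; field_simp
  rw [h4, div_le_iff₀ (by positivity)]
  have h5 : F.phi t ^ 2 * (1 + F.rhoM t / F.rhoPhi n lam t) * F.rhoPhi n lam t ^ 2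
      = F.phi t ^ 2 * (F.rhoPhi n lam t + F.rhoM t) * F.rhoPhi n lam t := by
    field_simp
  have h6 : 0 ≤ F.phi t ^ 2 * (F.rhoPhi n lam t + F.rhoM t) := by positivity
  rw [h5]
  nlinarith

end IsSolutionOn

end FlatFLRW

/-! ### Asymptotics of the ratio in the three regimes. -/

namespace FlatFLRW

variable {n : ℕ} {lam gam : ℝ} {F : Fields} {I : Set ℝ}

namespace IsSolutionOn

section Asymptotics

variable {a : ℝ}

theorem tendsto_log_rhoM (hgam : 0 < gam) (h : IsSolutionOn n lam gam F I) (ha : Ici a ⊆ I)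
    (hrho : ∀ t ≥ a, 0 < F.rhoM t) :
    Tendsto (fun t => Real.log (F.rhoM t)) atTop atBot :=
  Real.tendsto_log_nhdsGT_zero.comp <| tendsto_nhdsWithin_iff.2
    ⟨h.tendsto_rhoM hgam ha, (eventually_ge_atTop a).mono hrho⟩

theorem tendsto_rhoPhi_rpow (hn : 1 ≤ n) (hlam : 0 < lam) (hgam : 0 < gam)
    (h : IsSolutionOn n lam gam F I) (ha : Ici a ⊆ I) :
    Tendsto (fun t => F.rhoPhi n lam t ^ (n : ℝ)⁻¹) atTop (𝓝 0) := by
  have hn0 : (0 : ℝ) < (n : ℝ)⁻¹ := by positivity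
  have := (h.tendsto_rhoPhi hn hlam hgam ha).rpow_const (p := (n : ℝ)⁻¹) (Or.inr hn0.le)
  rwa [Real.zero_rpow hn0.ne'] at this

theorem tendsto_sq_phi (hn : 1 ≤ n) (hlam : 0 < lam) (hgam : 0 < gam)
    (h : IsSolutionOn n lam gam F I) (ha : Ici a ⊆ I) :
    Tendsto (fun t => F.phi t ^ 2) atTop (𝓝 0) := by
  have := (h.tendsto_rhoPhi_rpow hn hlam hgam ha).const_mul
    ((2 * n : ℝ) ^ (n : ℝ)⁻¹ / lam ^ 2)
  rw [mul_zero] at this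
  exact squeeze_zero (fun t => sq_nonneg _) (fun t => F.sq_phi_le hn hlam t) this

theorem abs_virial_correction_le (hn : 1 ≤ n) (x : ℝ) :
    |3 / (n + 1 : ℝ) * x| ≤ 3 / 2 * |x| := by
  have hn1 : (1 : ℝ) ≤ n := by exact_mod_cast hn
  rw [abs_mul, abs_of_nonneg (by positivity : 0 ≤ 3 / (n + 1 : ℝ))]
  gcongr; linarith

/-- The bound on `w` degenerates as `r → 0`, so for each level `η` the drift is used only while `r ≥
η`. It pushes `r` below `η`, and any later excursion above `η` is limited to `2η`. -/
theorem tendsto_ratio_zero (hn : 1 ≤ n) (hlam : 0 < lam) (hgam : 0 < gam) (hgam2 : gam < 2)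
    (h : IsSolutionOn n lam gam F I) (ha : Ici a ⊆ I) (hphi : ∀ t ≥ a, 0 < F.rhoPhi n lam t)
    (hrho : ∀ t ≥ a, 0 < F.rhoM t) (hlt : gam < 2 * n / (n + 1)) :
    Tendsto (fun t => F.ratio n lam t) atTop (𝓝 0) := by
  set d := 2 * n / (n + 1) - gam with hd
  have hd0 : 0 < d := by linarith
  have hL : ∀ t ≥ a, ∃ e, |e| ≤ 9 * F.hubble t * |F.virial n lam t| ∧
      HasDerivAt (F.averagedLogRatio n lam)
        (3 * F.hubble t * (gam - 2 * n / (n + 1)) + e) t := fun t ht =>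
    h.hasDerivAt_averagedLogRatio hn hgam hgam2 (ha ht) (hphi t ht) (hrho t ht)
  choose! e he hL using hL
  have hcont : ContinuousOn (fun t => F.ratio n lam t) (Ici a) := fun t ht =>
    ((h.hasDerivAt_rhoPhi hn (ha ht)).continuousAt.div (h.fluid t (ha ht)).continuousAt
      (hrho t ht).ne').continuousWithinAt
  have hlog : ∀ t ≥ a, Real.log (F.ratio n lam t) =
      F.averagedLogRatio n lam t - 3 / (n + 1) * F.virial n lam t := fun t ht => by
    rw [Fields.ratio, Real.log_div (hphi t ht).ne' (hrho t ht).ne', Fields.averagedLogRatio]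
    ring
  suffices hkey : ∀ η > 0, ∃ T ≥ a, ∀ t ≥ T, F.ratio n lam t ≤ 2 * η by
    rw [Metric.tendsto_atTop]
    intro ε hε
    obtain ⟨T, hTa, hT⟩ := hkey (ε / 4) (by positivity)
    refine ⟨T, fun t ht => ?_⟩
    have hpos : 0 < F.ratio n lam t := div_pos (hphi t (hTa.le.trans ht)) (hrho t (hTa.le.trans ht))
    rw [Real.dist_eq, sub_zero, abs_of_pos hpos]
    linarith [hT t ht]
  intro η hη
  -- With `|w| ≤ d/6` the error takes at most half of the drift `-3dH`; with `|w| ≤ 1/6` the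
  -- correction to `log r` is at most `1/4`.
  set σ := min (d / 6) (1 / 6) with hσ
  have hσ0 : 0 < σ := by positivity
  have hsmall : ∀ᶠ t in atTop, F.phi t ^ 2 * (1 + 1 / η) ≤ σ ^ 2 := by
    have := (h.tendsto_sq_phi hn hlam hgam ha).mul_const (1 + 1 / η)
    rw [zero_mul] at this
    exact this.eventually (eventually_le_nhds (by positivity))
  obtain ⟨T, hTa, hT⟩ : ∃ T ≥ a, ∀ t ≥ T, F.phi t ^ 2 * (1 + 1 / η) ≤ σ ^ 2 := by
    obtain ⟨T, hT⟩ := eventually_atTop.1 hsmall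
    exact ⟨max a T, le_max_left _ _, fun t ht => hT t ((le_max_right _ _).trans ht)⟩
  have hvir : ∀ t ≥ T, η ≤ F.ratio n lam t → |F.virial n lam t| ≤ σ := fun t ht hr => by
    have hta : t ≥ a := ge_trans ht hTa
    refine abs_le_of_sq_le_sq ((h.sq_virial_le (ha hta) (hphi t hta)).trans
      (le_trans ?_ (hT t ht))) hσ0.le
    have h1 : F.rhoM t / F.rhoPhi n lam t = 1 / F.ratio n lam t := by
      rw [Fields.ratio, one_div_div]
    rw [h1]
    gcongr
  have hdecr : ∀ t ≥ T, η ≤ F.ratio n lam t →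
      3 * F.hubble t * (gam - 2 * n / (n + 1)) + e t ≤ -(3 / 2 * d * F.hubble t) :=
    fun t ht hr => by
      have hta : t ≥ a := ge_trans ht hTa
      have h1 := (le_abs_self _).trans (he t hta)
      have h2 : |F.virial n lam t| ≤ d / 6 := (hvir t ht hr).trans (min_le_left _ _)
      have h3 := h.hubble_pos t (ha hta)
      have h4 : 9 * F.hubble t * |F.virial n lam t| ≤ 9 * F.hubble t * (d / 6) := by gcongr
      have h5 : gam - 2 * n / (n + 1) = -d := by rw [hd]; ring
      rw [h5]; linarith
  have hcorr : ∀ t ≥ T, η ≤ F.ratio n lam t →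
      |3 / (n + 1) * F.virial n lam t| ≤ 1 / 4 := fun t ht hr => by
    have h1 := abs_virial_correction_le hn (F.virial n lam t)
    have h2 : |F.virial n lam t| ≤ 1 / 6 := (hvir t ht hr).trans (min_le_right _ _)
    linarith
  -- Otherwise `L` would fall at least as fast as `d/(2γ_m) log ρ_m`, which tends to `-∞`, whereas
  -- `log r ≥ log η`.
  obtain ⟨t₁, ht₁T, ht₁⟩ : ∃ t ≥ T, F.ratio n lam t < η := by
    by_contra! hcon
    have hanti := antitoneOn_of_hasDerivAt_nonpos (convex_Ici T)
      (f := fun t => F.averagedLogRatio n lam t - d / (2 * gam) * Real.log (F.rhoM t))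
      (fun t ht => (hL t (ge_trans ht hTa)).sub
        ((h.hasDerivAt_log_rhoM (ha (ge_trans ht hTa))
          (hrho t (ge_trans ht hTa))).const_mul (d / (2 * gam))))
      (fun t ht => by
        have h1 := hdecr t ht (hcon t ht)
        have h2 : d / (2 * gam) * -(3 * gam * F.hubble t) = -(3 / 2 * d * F.hubble t) := by
          field_simp
        linarith)
    set C := F.averagedLogRatio n lam T - d / (2 * gam) * Real.log (F.rhoM T) with hC
    have hbot := (h.tendsto_log_rhoM hgam ha hrho).const_mul_atBot
      (by positivity : 0 < d / (2 * gam))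
    obtain ⟨t, ht, htT⟩ := ((hbot.eventually
      (eventually_lt_atBot (Real.log η - 1 / 4 - C))).and (eventually_ge_atTop T)).exists
    have h1 : F.averagedLogRatio n lam t - d / (2 * gam) * Real.log (F.rhoM t) ≤ C :=
      hanti (mem_Ici.2 le_rfl) (mem_Ici.2 htT) htT
    have h2 := hlog t (ge_trans htT hTa)
    have h3 := (abs_le.1 (hcorr t htT (hcon t htT))).1
    have h4 := Real.log_le_log hη (hcon t htT)
    linarith
  refine ⟨t₁, ge_trans ht₁T hTa, fun t ht => ?_⟩
  by_contra! hcon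
  have hcont' : ∀ u ≥ t₁, ContinuousOn (fun t => F.ratio n lam t) (Icc u t) := fun u hu =>
    hcont.mono fun v hv => ge_trans (ge_trans hv.1 hu) (ge_trans ht₁T hTa)
  have hcompact : IsCompact (Icc t₁ t ∩ (fun t => F.ratio n lam t) ⁻¹' {η}) :=
    isCompact_Icc.of_isClosed_subset
      ((hcont' t₁ le_rfl).preimage_isClosed_of_isClosed isClosed_Icc isClosed_singleton)
      inter_subset_left
  have hne : (Icc t₁ t ∩ (fun t => F.ratio n lam t) ⁻¹' {η}).Nonempty := by
    obtain ⟨s, hs, hs'⟩ := intermediate_value_Icc ht (hcont' t₁ le_rfl)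
      (show η ∈ Icc _ _ from ⟨ht₁.le, by linarith⟩)
    exact ⟨s, hs, hs'⟩
  -- The last time `s ≤ t` at which `r = η`; on `[s, t]` the ratio stays at least `η`, so `L`
  -- decreases there.
  obtain ⟨s, ⟨hs, hsη⟩, hsmax⟩ := hcompact.exists_isGreatest hne
  have hsη : F.ratio n lam s = η := hsη
  have hge : ∀ u ∈ Icc s t, η ≤ F.ratio n lam u := fun u hu => by
    by_contra! hlt'
    obtain ⟨v, hv, hvη⟩ := intermediate_value_Icc hu.2 (hcont' u (hs.1.trans hu.1))
      (show η ∈ Icc _ _ from ⟨hlt'.le, by linarith⟩)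
    have h1 : v ≤ s := hsmax ⟨⟨(hs.1.trans hu.1).trans hv.1, hv.2⟩, hvη⟩
    have h2 : u = s := le_antisymm (hv.1.trans h1) hu.1
    rw [h2, hsη] at hlt'
    exact lt_irrefl _ hlt'
  have hsT : T ≤ s := le_trans ht₁T hs.1
  have hanti := antitoneOn_of_hasDerivAt_nonpos (convex_Icc s t)
    (fun u hu => hL u (ge_trans (hsT.trans hu.1) hTa))
    (fun u hu => (hdecr u (hsT.trans hu.1) (hge u hu)).trans (by
      have := h.hubble_pos u (ha (ge_trans (hsT.trans hu.1) hTa))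
      have : 0 < 3 / 2 * d * F.hubble u := by positivity
      linarith))
  have h1 := hanti (left_mem_Icc.2 hs.2) (right_mem_Icc.2 hs.2) hs.2
  have h2 := hlog s (ge_trans hsT hTa)
  have h3 := hlog t (ge_trans (hsT.trans hs.2) hTa)
  have h4 := (abs_le.1 (hcorr s hsT hsη.ge)).2
  have h5 := (abs_le.1 (hcorr t (hsT.trans hs.2) (hge t (right_mem_Icc.2 hs.2)))).1
  have h6 := Real.log_lt_log (by positivity) hcon
  rw [Real.log_mul two_ne_zero hη.ne'] at h6
  rw [hsη] at h2
  -- The corrections at both ends allow `log r` to rise by at most `1/2 < log 2`.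
  linarith [Real.log_two_gt_d9]

/-- If the fluid is at least as stiff as the averaged scalar field, then the scalar field
oscillates ever faster on the Hubble time scale. -/
theorem exists_sq_virial_le (hn : 1 ≤ n) (hlam : 0 < lam)
    (h : IsSolutionOn n lam gam F I) (ha : Ici a ⊆ I) (hphi : ∀ t ≥ a, 0 < F.rhoPhi n lam t)
    (hrho : ∀ t ≥ a, 0 < F.rhoM t) (hge : 2 * n / (n + 1) ≤ gam) :
    ∃ C > 0, ∀ t ≥ a, F.virial n lam t ^ 2 ≤
      C * (F.rhoPhi n lam t ^ (n : ℝ)⁻¹ + F.rhoM t ^ ((n : ℝ) ^ 2)⁻¹) := by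
  have hn1 : (1 : ℝ) ≤ n := by exact_mod_cast hn
  have hn0 : (0 : ℝ) < n := by positivity
  have hinv : (n : ℝ)⁻¹ ≤ 1 := inv_le_one_of_one_le₀ hn1
  have hanti := antitoneOn_of_hasDerivAt_nonpos (convex_Ici a)
    -- The coefficients balance even the fastest possible decay of `ρ_φ`, at rate `6H`: `(1 - 1/n²)
    -- · 2n/(n+1) = 2(1 - 1/n)`. Hence `ρ_φ^(1/n) ρ_m/ρ_φ` is at most a constant times `ρ_m^(1/n²)`.
    (f := fun t => ((n : ℝ)⁻¹ - 1) * Real.log (F.rhoPhi n lam t)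
      + (1 - ((n : ℝ) ^ 2)⁻¹) * Real.log (F.rhoM t))
    (fun t ht => (((h.hasDerivAt_rhoPhi hn (ha ht)).log (hphi t ht).ne').const_mul _).add
      ((h.hasDerivAt_log_rhoM (ha ht) (hrho t ht)).const_mul _))
    (fun t ht => by
      have hH := h.hubble_pos t (ha ht)
      have h1 : -(3 * F.hubble t * F.phiDot t ^ 2) / F.rhoPhi n lam t ≥ -(6 * F.hubble t) := by
        rw [ge_iff_le, le_div_iff₀ (hphi t ht)]
        nlinarith [F.sq_phiDot_le n lam t]
      have h2 : ((n : ℝ)⁻¹ - 1) * (-(3 * F.hubble t * F.phiDot t ^ 2) / F.rhoPhi n lam t)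
          ≤ ((n : ℝ)⁻¹ - 1) * (-(6 * F.hubble t)) :=
        mul_le_mul_of_nonpos_left h1 (by linarith)
      have h3 : (0 : ℝ) ≤ 1 - ((n : ℝ) ^ 2)⁻¹ := by
        have : ((n : ℝ) ^ 2)⁻¹ ≤ 1 := inv_le_one_of_one_le₀ (one_le_pow₀ hn1)
        linarith
      have h4 : (1 - ((n : ℝ) ^ 2)⁻¹) * (2 * n / (n + 1)) ≤ (1 - ((n : ℝ) ^ 2)⁻¹) * gam := by
        gcongr
      have h5 : (1 - ((n : ℝ) ^ 2)⁻¹) * (2 * n / (n + 1)) = 2 * (1 - (n : ℝ)⁻¹) := by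
        field_simp; ring
      rw [h5] at h4
      nlinarith)
  set c := ((n : ℝ)⁻¹ - 1) * Real.log (F.rhoPhi n lam a)
      + (1 - ((n : ℝ) ^ 2)⁻¹) * Real.log (F.rhoM a) with hc
  set K := (2 * n : ℝ) ^ (n : ℝ)⁻¹ / lam ^ 2 with hK
  have hK0 : 0 < K := by positivity
  refine ⟨K * (1 + Real.exp c), by positivity, fun t ht => ?_⟩
  have hp := hphi t ht
  have hr := hrho t ht
  have h1 : ((n : ℝ)⁻¹ - 1) * Real.log (F.rhoPhi n lam t)
      + (1 - ((n : ℝ) ^ 2)⁻¹) * Real.log (F.rhoM t) ≤ c :=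
    hanti (mem_Ici.2 le_rfl) (mem_Ici.2 ht) ht
  have h2 : F.rhoPhi n lam t ^ (n : ℝ)⁻¹ * (F.rhoM t / F.rhoPhi n lam t)
      ≤ Real.exp c * F.rhoM t ^ ((n : ℝ) ^ 2)⁻¹ := by
    rw [← Real.exp_log (div_pos hr hp), Real.log_div hr.ne' hp.ne',
      Real.rpow_def_of_pos hp, Real.rpow_def_of_pos hr, ← Real.exp_add, ← Real.exp_add]
    apply Real.exp_le_exp.2
    linarith
  have h3 : F.virial n lam t ^ 2 ≤
      K * F.rhoPhi n lam t ^ (n : ℝ)⁻¹ * (1 + F.rhoM t / F.rhoPhi n lam t) :=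
    (h.sq_virial_le (ha ht) hp).trans
      (mul_le_mul_of_nonneg_right (F.sq_phi_le hn hlam t) (by positivity))
  have h4 : 0 < F.rhoPhi n lam t ^ (n : ℝ)⁻¹ := by positivity
  have h5 : 0 < F.rhoM t ^ ((n : ℝ) ^ 2)⁻¹ := by positivity
  calc F.virial n lam t ^ 2
      ≤ K * (F.rhoPhi n lam t ^ (n : ℝ)⁻¹
        + F.rhoPhi n lam t ^ (n : ℝ)⁻¹ * (F.rhoM t / F.rhoPhi n lam t)) := by linarith
    _ ≤ K * (F.rhoPhi n lam t ^ (n : ℝ)⁻¹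
        + Real.exp c * F.rhoM t ^ ((n : ℝ) ^ 2)⁻¹) := by gcongr
    _ ≤ _ := by
      have : 0 ≤ K * (Real.exp c * F.rhoPhi n lam t ^ (n : ℝ)⁻¹ + F.rhoM t ^ ((n : ℝ) ^ 2)⁻¹) := by
        positivity
      linarith

theorem tendsto_virial (hn : 1 ≤ n) (hlam : 0 < lam) (hgam : 0 < gam)
    (h : IsSolutionOn n lam gam F I) (ha : Ici a ⊆ I) (hphi : ∀ t ≥ a, 0 < F.rhoPhi n lam t)
    (hrho : ∀ t ≥ a, 0 < F.rhoM t) (hge : 2 * n / (n + 1) ≤ gam) :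
    Tendsto (F.virial n lam) atTop (𝓝 0) := by
  obtain ⟨C, -, hC⟩ := h.exists_sq_virial_le hn hlam ha hphi hrho hge
  have hn0 : (0 : ℝ) < ((n : ℝ) ^ 2)⁻¹ := by positivity
  have h1 := (h.tendsto_rhoM hgam ha).rpow_const (p := ((n : ℝ) ^ 2)⁻¹) (Or.inr hn0.le)
  rw [Real.zero_rpow hn0.ne'] at h1
  have h2 := ((h.tendsto_rhoPhi_rpow hn hlam hgam ha).add h1).const_mul C
  rw [add_zero, mul_zero] at h2
  have h3 : Tendsto (fun t => F.virial n lam t ^ 2) atTop (𝓝 0) :=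
    squeeze_zero' (Eventually.of_forall fun t => sq_nonneg _)
      ((eventually_ge_atTop a).mono hC) h2
  have h4 := h3.sqrt
  simp only [Real.sqrt_sq_eq_abs, Real.sqrt_zero] at h4
  exact (tendsto_zero_iff_abs_tendsto_zero _).2 h4

theorem eventually_abs_virial_le (hn : 1 ≤ n) (hlam : 0 < lam) (hgam : 0 < gam)
    (h : IsSolutionOn n lam gam F I) (ha : Ici a ⊆ I) (hphi : ∀ t ≥ a, 0 < F.rhoPhi n lam t)
    (hrho : ∀ t ≥ a, 0 < F.rhoM t) (hge : 2 * n / (n + 1) ≤ gam) {σ : ℝ} (hσ : 0 < σ) :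
    ∃ T ≥ a, ∀ t ≥ T, |F.virial n lam t| ≤ σ := by
  have h1 := (h.tendsto_virial hn hlam hgam ha hphi hrho hge).abs
  rw [abs_zero] at h1
  obtain ⟨T, hT⟩ := eventually_atTop.1 (h1.eventually (eventually_le_nhds hσ))
  exact ⟨max a T, le_max_left _ _, fun t ht => hT t ((le_max_right _ _).trans ht)⟩

theorem ratio_eq_exp {t : ℝ} (hphi : 0 < F.rhoPhi n lam t) (hrho : 0 < F.rhoM t) :
    F.ratio n lam t =
      Real.exp (F.averagedLogRatio n lam t - 3 / (n + 1) * F.virial n lam t) := by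
  rw [Fields.averagedLogRatio, add_sub_cancel_right, ← Real.log_div hphi.ne' hrho.ne',
    Real.exp_log (div_pos hphi hrho), Fields.ratio]

/-- Once `|w| ≤ d/6`, at least half of the drift survives, so `L` grows at least like `-d/(2γ_m) log
ρ_m`. -/
theorem tendsto_ratio_atTop (hn : 1 ≤ n) (hlam : 0 < lam) (hgam : 0 < gam) (hgam2 : gam < 2)
    (h : IsSolutionOn n lam gam F I) (ha : Ici a ⊆ I) (hphi : ∀ t ≥ a, 0 < F.rhoPhi n lam t)
    (hrho : ∀ t ≥ a, 0 < F.rhoM t) (hgt : 2 * n / (n + 1) < gam) :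
    Tendsto (fun t => F.ratio n lam t) atTop atTop := by
  set d := gam - 2 * n / (n + 1) with hd
  have hd0 : 0 < d := by linarith
  have hL : ∀ t ≥ a, ∃ e, |e| ≤ 9 * F.hubble t * |F.virial n lam t| ∧
      HasDerivAt (F.averagedLogRatio n lam) (3 * F.hubble t * d + e) t := fun t ht =>
    h.hasDerivAt_averagedLogRatio hn hgam hgam2 (ha ht) (hphi t ht) (hrho t ht)
  choose! e he hL using hL
  obtain ⟨T, hTa, hT⟩ := h.eventually_abs_virial_le hn hlam hgam ha hphi hrho hgt.le
    (by positivity : 0 < d / 6)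
  have hmono := monotoneOn_of_hasDerivAt_nonneg (convex_Ici T)
    (f := fun t => F.averagedLogRatio n lam t + d / (2 * gam) * Real.log (F.rhoM t))
    (fun t ht => (hL t (ge_trans ht hTa)).add
      ((h.hasDerivAt_log_rhoM (ha (ge_trans ht hTa))
        (hrho t (ge_trans ht hTa))).const_mul (d / (2 * gam))))
    (fun t ht => by
      have hta : t ≥ a := ge_trans ht hTa
      have h1 := (neg_le_abs _).trans (he t hta)
      have h3 := h.hubble_pos t (ha hta)
      have h4 : 9 * F.hubble t * |F.virial n lam t| ≤ 9 * F.hubble t * (d / 6) :=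
        mul_le_mul_of_nonneg_left (hT t ht) (by positivity)
      have h2 : d / (2 * gam) * -(3 * gam * F.hubble t) = -(3 / 2 * d * F.hubble t) := by
        field_simp
      linarith)
  set C := F.averagedLogRatio n lam T + d / (2 * gam) * Real.log (F.rhoM T) with hC
  have hbot := (h.tendsto_log_rhoM hgam ha hrho).const_mul_atBot
    (by positivity : 0 < d / (2 * gam))
  have htop := tendsto_atTop_add_const_left atTop (C - d / 4) (tendsto_neg_atBot_atTop.comp hbot)
  refine tendsto_atTop_mono' _ ?_ (Real.tendsto_exp_atTop.comp htop)
  filter_upwards [eventually_ge_atTop T] with t ht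
  have hta := ge_trans ht hTa
  rw [ratio_eq_exp (hphi t hta) (hrho t hta)]
  refine Real.exp_le_exp.2 ?_
  have h1 : C ≤ F.averagedLogRatio n lam t + d / (2 * gam) * Real.log (F.rhoM t) :=
    hmono (mem_Ici.2 le_rfl) (mem_Ici.2 ht) ht
  have h2 := (le_abs_self _).trans (abs_virial_correction_le hn (F.virial n lam t))
  have h3 := hT t ht
  simp only [Function.comp]
  linarith

/-- Without drift, `L` changes only through its error. Bounding `w` by a power of `ρ_m` makes this
error at most the rate of decrease of a multiple of that power, which tends to zero; so `L`
converges. -/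
theorem exists_tendsto_ratio (hn : 1 ≤ n) (hlam : 0 < lam) (hgam : 0 < gam) (hgam2 : gam < 2)
    (h : IsSolutionOn n lam gam F I) (ha : Ici a ⊆ I) (hphi : ∀ t ≥ a, 0 < F.rhoPhi n lam t)
    (hrho : ∀ t ≥ a, 0 < F.rhoM t) (heq : gam = 2 * n / (n + 1)) :
    ∃ c : ℝ, 0 < c ∧ Tendsto (fun t => F.ratio n lam t) atTop (𝓝 c) := by
  have hn1 : (1 : ℝ) ≤ n := by exact_mod_cast hn
  have hn0 : (0 : ℝ) < n := by positivity
  have hL : ∀ t ≥ a, ∃ e, |e| ≤ 9 * F.hubble t * |F.virial n lam t| ∧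
      HasDerivAt (F.averagedLogRatio n lam) e t := fun t ht => by
    have := h.hasDerivAt_averagedLogRatio hn hgam hgam2 (ha ht) (hphi t ht) (hrho t ht)
    simpa only [← heq, sub_self, mul_zero, zero_add] using this
  choose! e he hL using hL
  obtain ⟨T₀, hT₀a, hT₀⟩ := h.eventually_abs_virial_le hn hlam hgam ha hphi hrho heq.ge
    (by positivity : 0 < gam / 6)
  obtain ⟨T, hTT₀, hT⟩ : ∃ T ≥ T₀, ∀ t ≥ T, F.rhoM t ≤ 1 := by
    obtain ⟨T, hT⟩ := eventually_atTop.1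
      ((h.tendsto_rhoM hgam ha).eventually (eventually_le_nhds zero_lt_one))
    exact ⟨max T₀ T, le_max_left _ _, fun t ht => hT t ((le_max_right _ _).trans ht)⟩
  have hTa : ∀ t ≥ T, t ≥ a := fun t ht => ge_trans (ge_trans ht hTT₀) hT₀a
  -- A first crude estimate: `|w| ≤ γ_m/6` already gives `ρ_φ ≤ e^B ρ_m^(1/2)`, which is fed back
  -- into the bound on `w`.
  have hanti := antitoneOn_of_hasDerivAt_nonpos (convex_Ici T)
    (f := fun t => F.averagedLogRatio n lam t + 1 / 2 * Real.log (F.rhoM t))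
    (fun t ht => (hL t (hTa t ht)).add
      ((h.hasDerivAt_log_rhoM (ha (hTa t ht)) (hrho t (hTa t ht))).const_mul (1 / 2)))
    (fun t ht => by
      have h1 := (le_abs_self _).trans (he t (hTa t ht))
      have h3 := h.hubble_pos t (ha (hTa t ht))
      have h4 : 9 * F.hubble t * |F.virial n lam t| ≤ 9 * F.hubble t * (gam / 6) :=
        mul_le_mul_of_nonneg_left (hT₀ t (ge_trans ht hTT₀)) (by positivity)
      linarith)
  set B := F.averagedLogRatio n lam T + 1 / 2 * Real.log (F.rhoM T) + gam / 4 with hB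
  have hphi_le : ∀ t ≥ T, Real.log (F.rhoPhi n lam t) ≤ B + 1 / 2 * Real.log (F.rhoM t) :=
    fun t ht => by
      have h1 := hanti (mem_Ici.2 le_rfl) (mem_Ici.2 ht) ht
      have h2 := (neg_le_abs _).trans (abs_virial_correction_le hn (F.virial n lam t))
      have h3 := hT₀ t (ge_trans ht hTT₀)
      have h4 : F.averagedLogRatio n lam t = Real.log (F.rhoPhi n lam t)
        - Real.log (F.rhoM t) + 3 / (n + 1) * F.virial n lam t := rfl
      simp only at h1
      linarith
  obtain ⟨C, hC0, hC⟩ := h.exists_sq_virial_le hn hlam ha hphi hrho heq.ge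
  -- Chosen so that `2ε = 1/(2n²)` is below both exponents `1/(2n)` and `1/n²` occurring in the
  -- bound on `w²`.
  set ε := (4 * (n : ℝ) ^ 2)⁻¹ with hε
  have hε0 : 0 < ε := by positivity
  set D := C * (Real.exp (B * (n : ℝ)⁻¹) + 1) with hD
  have hD0 : 0 < D := by positivity
  have hvir : ∀ t ≥ T, |F.virial n lam t| ≤ √D * F.rhoM t ^ ε := fun t ht => by
    have hr := hrho t (hTa t ht)
    have hp := hphi t (hTa t ht)
    have hlog : Real.log (F.rhoM t) ≤ 0 := Real.log_nonpos hr.le (hT t ht)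
    have h1 : F.rhoPhi n lam t ^ (n : ℝ)⁻¹ ≤ Real.exp (B * (n : ℝ)⁻¹) * F.rhoM t ^ (2 * ε) := by
      rw [Real.rpow_def_of_pos hp, Real.rpow_def_of_pos hr, ← Real.exp_add]
      apply Real.exp_le_exp.2
      have h2 : Real.log (F.rhoPhi n lam t) * (n : ℝ)⁻¹ ≤
          (B + 1 / 2 * Real.log (F.rhoM t)) * (n : ℝ)⁻¹ := by
        have := hphi_le t ht
        gcongr
      have h3 : 2 * ε ≤ 1 / 2 * (n : ℝ)⁻¹ := by
        rw [hε]; field_simp; nlinarith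
      have h4 := mul_le_mul_of_nonpos_left h3 hlog
      linarith
    have h2 : F.rhoM t ^ ((n : ℝ) ^ 2)⁻¹ ≤ F.rhoM t ^ (2 * ε) :=
      Real.rpow_le_rpow_of_exponent_ge hr (hT t ht) (by rw [hε]; field_simp; norm_num)
    refine abs_le_of_sq_le_sq ?_ (by positivity)
    have h3 : (F.rhoM t ^ ε) ^ 2 = F.rhoM t ^ (2 * ε) := by
      rw [← Real.rpow_natCast, ← Real.rpow_mul hr.le]; congr 1; push_cast; ring
    rw [mul_pow, Real.sq_sqrt hD0.le, h3]
    calc F.virial n lam t ^ 2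
        ≤ C * (Real.exp (B * (n : ℝ)⁻¹) * F.rhoM t ^ (2 * ε) + F.rhoM t ^ (2 * ε)) :=
          (hC t (hTa t ht)).trans (by gcongr)
      _ = _ := by rw [hD]; ring
  -- Makes the derivative of `G ρ_m^ε` exactly minus the error bound.
  set G := 3 * √D / (gam * ε) with hG
  have hG0 : 0 ≤ G := by positivity
  have hpow : ∀ t ≥ T, HasDerivAt (fun t => G * F.rhoM t ^ ε)
      (-(9 * F.hubble t * (√D * F.rhoM t ^ ε))) t := fun t ht => by
    have hr := hrho t (hTa t ht)
    refine (((h.fluid t (ha (hTa t ht))).rpow_const (p := ε)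
      (Or.inl hr.ne')).const_mul G).congr_deriv ?_
    rw [Real.rpow_sub_one hr.ne', hG]
    field_simp
    ring
  have hle : ∀ t ≥ T, |e t| ≤ 9 * F.hubble t * (√D * F.rhoM t ^ ε) := fun t ht =>
    (he t (hTa t ht)).trans (mul_le_mul_of_nonneg_left (hvir t ht)
      (by have := h.hubble_pos t (ha (hTa t ht)); positivity))
  have hrho0 := (h.tendsto_rhoM hgam ha).rpow_const (p := ε) (Or.inr hε0.le)
  rw [Real.zero_rpow hε0.ne'] at hrho0
  have hrho0 := hrho0.const_mul G
  rw [mul_zero] at hrho0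
  obtain ⟨l, hl⟩ := exists_tendsto_of_monotoneOn_sub_of_antitoneOn_add (a := T)
    (f := F.averagedLogRatio n lam) (g := fun t => G * F.rhoM t ^ ε)
    (monotoneOn_of_hasDerivAt_nonneg (convex_Ici T)
      (fun t ht => (hL t (hTa t ht)).sub (hpow t ht))
      (fun t ht => by linarith [(abs_le.1 (hle t ht)).1]))
    (antitoneOn_of_hasDerivAt_nonpos (convex_Ici T)
      (fun t ht => (hL t (hTa t ht)).add (hpow t ht))
      (fun t ht => by linarith [(abs_le.1 (hle t ht)).2]))
    (fun t ht => by have := hrho t (hTa t ht); positivity) hrho0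
  refine ⟨Real.exp l, Real.exp_pos l, ?_⟩
  have h1 := hl.sub ((h.tendsto_virial hn hlam hgam ha hphi hrho heq.ge).const_mul
    (3 / (n + 1 : ℝ)))
  rw [mul_zero, sub_zero] at h1
  refine ((Real.continuous_exp.tendsto l).comp h1).congr' ?_
  filter_upwards [eventually_ge_atTop a] with t ht
  exact (ratio_eq_exp (hphi t ht) (hrho t ht)).symm

end Asymptotics

end IsSolutionOn

end FlatFLRW

/-! ### Continuation of integral curves. -/

section Continuation

variable {E : Type*} [NormedAddCommGroup E] [NormedSpace ℝ E]

theorem hasDerivAt_fst {E' : Type*} [NormedAddCommGroup E'] [NormedSpace ℝ E'] {Y : ℝ → E × E'}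
    {d : E × E'} {t : ℝ} (h : HasDerivAt Y d t) : HasDerivAt (fun t => (Y t).1) d.1 t :=
  (ContinuousLinearMap.fst ℝ E E').hasFDerivAt.comp_hasDerivAt t h

theorem hasDerivAt_snd {E' : Type*} [NormedAddCommGroup E'] [NormedSpace ℝ E'] {Y : ℝ → E × E'}
    {d : E × E'} {t : ℝ} (h : HasDerivAt Y d t) : HasDerivAt (fun t => (Y t).2) d.2 t :=
  (ContinuousLinearMap.snd ℝ E E').hasFDerivAt.comp_hasDerivAt t h

/-- The left derivative at the junction is the limit of the derivatives of `f`, the right one is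
that of `g`; they agree. -/
theorem hasDerivAt_ite_lt {f g f' : ℝ → E} {a T : ℝ} {d : E} (haT : a < T)
    (hf : ∀ t ∈ Ioo a T, HasDerivAt f (f' t) t) (hlim : Tendsto f (𝓝[<] T) (𝓝 (g T)))
    (hlim' : Tendsto f' (𝓝[<] T) (𝓝 d)) (hg : HasDerivAt g d T) :
    HasDerivAt (fun t => if t < T then f t else g t) d T := by
  have hmem : Ioo a T ∈ 𝓝[<] T := Ioo_mem_nhdsLT haT
  have hG : ∀ t ∈ Ioo a T, HasDerivAt (fun t => if t < T then f t else g t) (f' t) t :=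
    fun t ht => (hf t ht).congr_of_eventuallyEq <| by
      filter_upwards [Iio_mem_nhds ht.2] with s hs
      exact if_pos hs
  have hleft : HasDerivWithinAt (fun t => if t < T then f t else g t) d (Iic T) T := by
    refine hasDerivWithinAt_Iic_of_tendsto_deriv (s := Ioo a T)
      (fun t ht => (hG t ht).differentiableAt.differentiableWithinAt) ?_ hmem ?_
    · rw [ContinuousWithinAt, if_neg (lt_irrefl T)]
      refine (hlim.mono_left (nhdsWithin_mono _ Ioo_subset_Iio_self)).congr' ?_
      filter_upwards [self_mem_nhdsWithin] with s hs
      exact (if_pos hs.2).symm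
    · refine hlim'.congr' ?_
      filter_upwards [hmem] with s hs
      exact (hG s hs).deriv.symm
  have hright : HasDerivWithinAt (fun t => if t < T then f t else g t) d (Ici T) T :=
    hg.hasDerivWithinAt.congr (fun s hs => if_neg (not_lt.2 hs)) (if_neg (lt_irrefl T))
  simpa [Iic_union_Ici] using hleft.union hright

/-- An integral curve of an autonomous `C¹` vector field that stays in a compact set can be
continued. -/
theorem exists_integralCurve_continuation [CompleteSpace E] {v : E → E} (hv : ContDiff ℝ 1 v)
    {K : Set E} (hK : IsCompact K) {X : ℝ → E} {a T : ℝ} (haT : a < T)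
    (hX : ∀ t ∈ Ico a T, HasDerivAt X (v (X t)) t) (hXK : ∀ t ∈ Ico a T, X t ∈ K) :
    ∃ (Y : ℝ → E), ∃ ε > 0, (∀ t < T, Y t = X t) ∧ Y T ∈ K ∧
      ∀ t ∈ Ioo a (T + ε), HasDerivAt Y (v (Y t)) t := by
  obtain ⟨C, hC⟩ := hK.exists_bound_of_continuousOn hv.continuous.continuousOn
  -- Bounded speed on the compact set makes the curve Lipschitz, so it has a limit at `T`, from
  -- which a local solution is started.
  have hlip : LipschitzOnWith C.toNNReal X (Ico a T) :=
    (convex_Ico a T).lipschitzOnWith_of_nnnorm_hasDerivWithin_le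
      (fun t ht => (hX t ht).hasDerivWithinAt)
      (fun t ht => by
        rw [← norm_toNNReal]
        exact Real.toNNReal_le_toNNReal (hC _ (hXK t ht)))
  have hmem : Ico a T ∈ 𝓝[<] T := Ico_mem_nhdsLT haT
  have hcauchy : Cauchy (map X (𝓝[<] T)) :=
    Cauchy.map_of_le ((cauchy_nhds (a := T)).mono nhdsWithin_le_nhds)
      hlip.uniformContinuousOn (le_principal_iff.2 hmem)
  obtain ⟨x, hx⟩ := CompleteSpace.complete hcauchy
  have hx : Tendsto X (𝓝[<] T) (𝓝 x) := hx
  have hxK : x ∈ K := hK.isClosed.mem_of_tendsto hx (mem_of_superset hmem hXK)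
  obtain ⟨Z, hZT, ε, hε, hZ⟩ :=
    hv.contDiffAt.exists_forall_mem_closedBall_exists_eq_forall_mem_Ioo_hasDerivAt₀ (x₀ := x) T
  refine ⟨fun t => if t < T then X t else Z t, ε, hε, fun t ht => if_pos ht, ?_, ?_⟩
  · simpa only [lt_irrefl, if_false, hZT] using hxK
  intro t ht
  rcases lt_trichotomy t T with htT | rfl | htT
  · simp only [if_pos htT]
    refine (hX t ⟨ht.1.le, htT⟩).congr_of_eventuallyEq ?_
    filter_upwards [Iio_mem_nhds htT] with s hs
    exact if_pos hs
  · simp only [lt_irrefl, if_false]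
    rw [hZT]
    refine hasDerivAt_ite_lt haT (fun s hs => hX s ⟨hs.1.le, hs.2⟩) (by rwa [hZT])
      ((hv.continuous.tendsto x).comp hx) ?_
    have := hZ t ⟨by linarith, by linarith⟩
    rwa [hZT] at this
  · simp only [if_neg (not_lt.2 htT.le)]
    refine (hZ t ⟨by linarith, ht.2⟩).congr_of_eventuallyEq ?_
    filter_upwards [Ioi_mem_nhds htT] with s hs
    exact if_neg (not_lt.2 (le_of_lt hs))

end Continuation

/-! ### Global existence toward the future. -/

namespace FlatFLRW

variable {n : ℕ} {lam gam : ℝ} {F : Fields} {I : Set ℝ}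

/-- The field equations as an autonomous vector field in the variables `(φ, φ̇, H, ρ_m)`. -/
noncomputable def vectorField (n : ℕ) (lam gam : ℝ) (x : ℝ × ℝ × ℝ × ℝ) : ℝ × ℝ × ℝ × ℝ :=
  (x.2.1, -(3 * x.2.2.1 * x.2.1) - lam ^ (2 * n) * x.1 ^ (2 * n - 1),
    -(x.2.1 ^ 2 + gam * x.2.2.2) / 2, -(3 * x.2.2.1 * gam * x.2.2.2))

theorem contDiff_vectorField (n : ℕ) (lam gam : ℝ) : ContDiff ℝ 1 (vectorField n lam gam) := by
  unfold vectorField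
  fun_prop

/-- The fields described by a curve in the variables `(φ, φ̇, H, ρ_m)`. -/
def Fields.ofCurve (Y : ℝ → ℝ × ℝ × ℝ × ℝ) : Fields where
  phi t := (Y t).1
  phiDot t := (Y t).2.1
  hubble t := (Y t).2.2.1
  rhoM t := (Y t).2.2.2

section Curve

variable {Y : ℝ → ℝ × ℝ × ℝ × ℝ} {t : ℝ}

theorem hasDerivAt_ofCurve_phi (h : HasDerivAt Y (vectorField n lam gam (Y t)) t) :
    HasDerivAt (Fields.ofCurve Y).phi ((Fields.ofCurve Y).phiDot t) t :=
  hasDerivAt_fst h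

theorem hasDerivAt_ofCurve_phiDot (h : HasDerivAt Y (vectorField n lam gam (Y t)) t) :
    HasDerivAt (Fields.ofCurve Y).phiDot
      (-(3 * (Fields.ofCurve Y).hubble t * (Fields.ofCurve Y).phiDot t)
        - lam ^ (2 * n) * (Fields.ofCurve Y).phi t ^ (2 * n - 1)) t :=
  hasDerivAt_fst (hasDerivAt_snd h)

theorem hasDerivAt_ofCurve_hubble (h : HasDerivAt Y (vectorField n lam gam (Y t)) t) :
    HasDerivAt (Fields.ofCurve Y).hubble
      (-((Fields.ofCurve Y).phiDot t ^ 2 + gam * (Fields.ofCurve Y).rhoM t) / 2) t :=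
  hasDerivAt_fst (hasDerivAt_snd (hasDerivAt_snd h))

theorem hasDerivAt_ofCurve_rhoM (h : HasDerivAt Y (vectorField n lam gam (Y t)) t) :
    HasDerivAt (Fields.ofCurve Y).rhoM
      (-(3 * (Fields.ofCurve Y).hubble t * gam * (Fields.ofCurve Y).rhoM t)) t :=
  hasDerivAt_snd (hasDerivAt_snd (hasDerivAt_snd h))

/-- The Gauss constraint is propagated by the remaining field equations. -/
theorem hasDerivAt_ofCurve_constraint (hn : 1 ≤ n)
    (h : HasDerivAt Y (vectorField n lam gam (Y t)) t) :
    HasDerivAt (fun t => 3 * (Fields.ofCurve Y).hubble t ^ 2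
      - ((Fields.ofCurve Y).rhoPhi n lam t + (Fields.ofCurve Y).rhoM t)) 0 t := by
  have h1 := ((hasDerivAt_ofCurve_phiDot h).pow 2).div_const 2
  have h2 := (hasDerivAt_potential hn lam ((Fields.ofCurve Y).phi t)).comp t
    (hasDerivAt_ofCurve_phi h)
  have h3 := ((hasDerivAt_ofCurve_hubble h).pow 2).const_mul 3
  refine HasDerivAt.congr_deriv (h3.sub ((h1.add h2).add (hasDerivAt_ofCurve_rhoM h))) ?_
  push_cast; ring

end Curve

namespace IsSolutionOn

theorem hasDerivAt_curve (h : IsSolutionOn n lam gam F I) {t : ℝ} (ht : t ∈ I) :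
    HasDerivAt (fun t => (F.phi t, F.phiDot t, F.hubble t, F.rhoM t))
      (vectorField n lam gam (F.phi t, F.phiDot t, F.hubble t, F.rhoM t)) t :=
  (h.hasDerivAt_phi t ht).prodMk ((h.kleinGordon t ht).prodMk
    ((h.raychaudhuri t ht).prodMk (h.fluid t ht)))

/-- A solution with fluid on an interval that is bounded above can be continued. -/
theorem exists_continuation (hn : 1 ≤ n) (hlam : 0 < lam) (hgam : 0 < gam)
    (h : IsSolutionOn n lam gam F I) {a : ℝ} (ha : a ∈ I) (hrho : 0 < F.rhoM a)
    (hbdd : BddAbove I) :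
    ∃ (G : Fields) (J : Set ℝ), IsSolutionOn n lam gam G J ∧ I ⊆ J ∧
      EqOn G.phi F.phi I ∧ EqOn G.phiDot F.phiDot I ∧ EqOn G.hubble F.hubble I ∧
      EqOn G.rhoM F.rhoM I ∧ ∃ s ∈ J, ∀ t ∈ I, t < s := by
  set T := sSup I with hTdef
  have hlt : ∀ t ∈ I, t < T := fun t ht => by
    obtain ⟨δ, hδ, hball⟩ := Metric.isOpen_iff.1 h.isOpen t ht
    have : t + δ / 2 ∈ I := hball (by
      rw [Metric.mem_ball, Real.dist_eq, add_sub_cancel_left, abs_of_pos (by positivity)]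
      linarith)
    have := le_csSup hbdd this
    linarith
  have hIco : ∀ t ∈ Ico a T, t ∈ I := fun t ht => by
    obtain ⟨s, hs, hts⟩ := exists_lt_of_lt_csSup h.nonempty ht.2
    exact h.ordConnected.out ha hs ⟨ht.1, hts.le⟩
  -- A positive lower bound for `ρ_m` up to time `T`; by the Gauss constraint it also keeps `H ≥
  -- √(m/3)`, so the limit state is still expanding.
  set m := F.rhoM a * Real.exp (-(3 * F.hubble a * gam * (T - a))) with hm
  have hm0 : 0 < m := by positivity
  set R := (2 * n : ℝ) ^ (n : ℝ)⁻¹ / lam ^ 2 * F.rhoPhi n lam a ^ (n : ℝ)⁻¹ with hR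
  set K : Set (ℝ × ℝ × ℝ × ℝ) := Icc (-√R) √R ×ˢ
    Icc (-√(2 * F.rhoPhi n lam a)) √(2 * F.rhoPhi n lam a) ×ˢ
    Icc √(m / 3) (F.hubble a) ×ˢ Icc m (F.rhoM a) with hK
  have hKcompact : IsCompact K :=
    isCompact_Icc.prod (isCompact_Icc.prod (isCompact_Icc.prod isCompact_Icc))
  have hmem : ∀ t ∈ Ico a T, (F.phi t, F.phiDot t, F.hubble t, F.rhoM t) ∈ K := fun t ht => by
    have htI := hIco t ht
    have h1 := h.antitoneOn_hubble hgam ha htI ht.1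
    have h2 := h.antitoneOn_rhoM hgam ha htI ht.1
    have h3 := h.antitoneOn_rhoPhi hn ha htI ht.1
    have h4 : m ≤ F.rhoM t := by
      refine le_trans ?_ (h.rhoM_lower_bound hgam ha htI ht.1)
      have := h.hubble_pos a ha
      have := ht.2.le
      rw [hm]
      gcongr
    have h5 : √(m / 3) ≤ F.hubble t := Real.sqrt_le_iff.2
      ⟨(h.hubble_pos t htI).le, by linarith [h.gauss t htI, F.rhoPhi_nonneg n lam t]⟩
    have h6 : F.phi t ^ 2 ≤ R := (F.sq_phi_le hn hlam t).trans (by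
      have := F.rhoPhi_nonneg n lam t
      rw [hR]
      gcongr)
    have h7 : F.phiDot t ^ 2 ≤ 2 * F.rhoPhi n lam a := by
      linarith [F.sq_phiDot_le n lam t]
    exact ⟨abs_le.1 (Real.abs_le_sqrt h6), abs_le.1 (Real.abs_le_sqrt h7), ⟨h5, h1⟩, h4, h2⟩
  obtain ⟨Y, ε, hε, hYX, hYT, hY⟩ := exists_integralCurve_continuation
    (contDiff_vectorField n lam gam) hKcompact (hlt a ha)
    (fun t ht => h.hasDerivAt_curve (hIco t ht)) hmem
  set G := Fields.ofCurve Y with hG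
  have hphi : ∀ t < T, G.phi t = F.phi t := fun t ht => congrArg (·.1) (hYX t ht)
  have hphiDot : ∀ t < T, G.phiDot t = F.phiDot t := fun t ht => congrArg (·.2.1) (hYX t ht)
  have hhubble : ∀ t < T, G.hubble t = F.hubble t := fun t ht => congrArg (·.2.2.1) (hYX t ht)
  have hrhoM : ∀ t < T, G.rhoM t = F.rhoM t := fun t ht => congrArg (·.2.2.2) (hYX t ht)
  have hYT' : Y T ∈ {x : ℝ × ℝ × ℝ × ℝ | 0 < x.2.2.1 ∧ 0 < x.2.2.2} :=
    ⟨lt_of_lt_of_le (by positivity) hYT.2.2.1.1, lt_of_lt_of_le hm0 hYT.2.2.2.1⟩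
  have hopen : IsOpen {x : ℝ × ℝ × ℝ × ℝ | 0 < x.2.2.1 ∧ 0 < x.2.2.2} :=
    (isOpen_lt (f := fun _ => (0 : ℝ)) (g := fun x : ℝ × ℝ × ℝ × ℝ => x.2.2.1)
      (by fun_prop) (by fun_prop)).inter
    (isOpen_lt (f := fun _ => (0 : ℝ)) (g := fun x : ℝ × ℝ × ℝ × ℝ => x.2.2.2)
      (by fun_prop) (by fun_prop))
  have haT := hlt a ha
  have hev := (hY T ⟨haT, by linarith⟩).continuousAt.eventually (hopen.mem_nhds hYT')
  obtain ⟨δ, hδ, hball⟩ := Metric.eventually_nhds_iff.1 hev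
  set η := min ε δ with hη
  have hη0 : 0 < η := lt_min hε hδ
  have hηε : η ≤ ε := min_le_left _ _
  have hηδ : η ≤ δ := min_le_right _ _
  have hpos : ∀ t ∈ Ico T (T + η), 0 < G.hubble t ∧ 0 < G.rhoM t := fun t ht =>
    hball (by rw [Real.dist_eq, abs_of_nonneg (by linarith [ht.1])]; linarith [ht.2])
  have hYη : ∀ t ∈ Ico T (T + η), HasDerivAt Y (vectorField n lam gam (Y t)) t := fun t ht =>
    hY t ⟨haT.trans_le ht.1, by linarith [ht.2]⟩
  have hcases : ∀ t ∈ I ∪ Ioo a (T + η), t ∈ I ∨ t ∈ Ico T (T + η) := by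
    rintro t (ht | ht)
    · exact Or.inl ht
    · rcases lt_or_ge t T with htT | htT
      · exact Or.inl (hIco t ⟨ht.1.le, htT⟩)
      · exact Or.inr ⟨htT, ht.2⟩
  have hrhoPhi : ∀ t < T, G.rhoPhi n lam t = F.rhoPhi n lam t := fun t ht => by
    rw [Fields.rhoPhi, Fields.rhoPhi, hphi t ht, hphiDot t ht]
  -- The constraint defect has zero derivative on the glued curve and vanishes at the midpoint of
  -- `[a, T]`, which lies in `I`.
  have hgauss : ∀ t ∈ Ico T (T + η),
      3 * G.hubble t ^ 2 = G.rhoPhi n lam t + G.rhoM t := fun t ht => by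
    have hmid : (a + T) / 2 ∈ Ico a T := ⟨by linarith, by linarith⟩
    have hsub : ∀ s ∈ Icc ((a + T) / 2) t, s ∈ Ioo a (T + ε) := fun s hs =>
      ⟨by linarith [hs.1], by linarith [hs.2, ht.2]⟩
    have hle : (a + T) / 2 ≤ t := by linarith [ht.1]
    have hdown := antitoneOn_of_hasDerivAt_nonpos (convex_Icc ((a + T) / 2) t)
      (fun s hs => hasDerivAt_ofCurve_constraint hn (hY s (hsub s hs))) (fun _ _ => le_rfl)
      (left_mem_Icc.2 hle) (right_mem_Icc.2 hle) hle
    have hup := monotoneOn_of_hasDerivAt_nonneg (convex_Icc ((a + T) / 2) t)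
      (fun s hs => hasDerivAt_ofCurve_constraint hn (hY s (hsub s hs))) (fun _ _ => le_rfl)
      (left_mem_Icc.2 hle) (right_mem_Icc.2 hle) hle
    have hg := h.gauss _ (hIco _ hmid)
    rw [← hhubble _ hmid.2, ← hrhoPhi _ hmid.2, ← hrhoM _ hmid.2] at hg
    simp only at hdown hup
    linarith
  have htrans : ∀ {f g : ℝ → ℝ} {d : ℝ} {t : ℝ}, t ∈ I → (∀ s < T, g s = f s) →
      HasDerivAt f d t → HasDerivAt g d t := fun ht hfg hf =>
    hf.congr_of_eventuallyEq (mem_of_superset (Iio_mem_nhds (hlt _ ht)) hfg)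
  refine ⟨G, I ∪ Ioo a (T + η), ?_, subset_union_left, fun t ht => hphi t (hlt t ht),
    fun t ht => hphiDot t (hlt t ht), fun t ht => hhubble t (hlt t ht),
    fun t ht => hrhoM t (hlt t ht), T, Or.inr ⟨haT, by linarith⟩, hlt⟩
  refine
    { isOpen := h.isOpen.union isOpen_Ioo
      ordConnected := ?_
      nonempty := h.nonempty.inl
      hubble_pos := fun t ht => ?_
      rhoM_nonneg := fun t ht => ?_
      gauss := fun t ht => ?_
      raychaudhuri := fun t ht => ?_
      hasDerivAt_phi := fun t ht => ?_
      kleinGordon := fun t ht => ?_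
      fluid := fun t ht => ?_ }
  · have hmid : (a + T) / 2 ∈ Ico a T := ⟨by linarith, by linarith⟩
    have hmid' : (a + T) / 2 ∈ Ioo a (T + η) := ⟨by linarith, by linarith⟩
    exact (IsPreconnected.union ((a + T) / 2) (hIco _ hmid) hmid'
      h.ordConnected.isPreconnected isPreconnected_Ioo).ordConnected
  all_goals rcases hcases t ht with ht | ht
  · rw [hhubble t (hlt t ht)]; exact h.hubble_pos t ht
  · exact (hpos t ht).1
  · rw [hrhoM t (hlt t ht)]; exact h.rhoM_nonneg t ht
  · exact (hpos t ht).2.le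
  · rw [hhubble t (hlt t ht), hrhoPhi t (hlt t ht), hrhoM t (hlt t ht)]; exact h.gauss t ht
  · exact hgauss t ht
  · rw [hphiDot t (hlt t ht), hrhoM t (hlt t ht)]
    exact htrans ht hhubble (h.raychaudhuri t ht)
  · exact hasDerivAt_ofCurve_hubble (hYη t ht)
  · rw [hphiDot t (hlt t ht)]
    exact htrans ht hphi (h.hasDerivAt_phi t ht)
  · exact hasDerivAt_ofCurve_phi (hYη t ht)
  · rw [hphi t (hlt t ht), hphiDot t (hlt t ht), hhubble t (hlt t ht)]
    exact htrans ht hphiDot (h.kleinGordon t ht)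
  · exact hasDerivAt_ofCurve_phiDot (hYη t ht)
  · rw [hhubble t (hlt t ht), hrhoM t (hlt t ht)]
    exact htrans ht hrhoM (h.fluid t ht)
  · exact hasDerivAt_ofCurve_rhoM (hYη t ht)

end IsSolutionOn

/-- A future maximal solution containing fluid exists for all later times. -/
theorem IsFutureMaximalSolutionOn.Ici_subset (hn : 1 ≤ n) (hlam : 0 < lam) (hgam : 0 < gam)
    (hF : IsFutureMaximalSolutionOn n lam gam F I) {a : ℝ} (ha : a ∈ I) (hrho : 0 < F.rhoM a)
    {t : ℝ} (ht : t ∈ I) : Ici t ⊆ I := by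
  have hbdd : ¬ BddAbove I := fun hbdd => by
    obtain ⟨G, J, hG, hIJ, h1, h2, h3, h4, s, hs, hlt⟩ :=
      hF.isSolutionOn.exists_continuation hn hlam hgam ha hrho hbdd
    obtain ⟨u, hu, hsu⟩ := hF.maximal G J hG hIJ h1 h2 h3 h4 s hs
    exact absurd (hlt u hu) (not_lt.2 hsu)
  intro s hs
  obtain ⟨u, hu, hsu⟩ := not_bddAbove_iff.1 hbdd s
  exact hF.isSolutionOn.ordConnected.out ht hu ⟨hs, hsu.le⟩

end FlatFLRW

theorem theorem1 (n : ℕ) (hn : 1 ≤ n) (lam gam : ℝ) (hlam : 0 < lam)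
    (hgam_pos : 0 < gam) (hgam_lt : gam < 2)
    (F : FlatFLRW.Fields) (I : Set ℝ)
    (hF : FlatFLRW.IsFutureMaximalSolutionOn n lam gam F I)
    (hpos : ∃ t ∈ I, 0 < F.rhoPhi n lam t * F.rhoM t) :
    (∀ t ∈ I, Set.Ici t ⊆ I) ∧
    (gam - 2 * (n : ℝ) / ((n : ℝ) + 1) > 0 →
      Filter.Tendsto (fun t => F.ratio n lam t) Filter.atTop Filter.atTop) ∧
    (gam - 2 * (n : ℝ) / ((n : ℝ) + 1) < 0 →
      Filter.Tendsto (fun t => F.ratio n lam t) Filter.atTop (nhds 0)) ∧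
    (gam - 2 * (n : ℝ) / ((n : ℝ) + 1) = 0 →
      ∃ c : ℝ, 0 < c ∧
        Filter.Tendsto (fun t => F.ratio n lam t) Filter.atTop (nhds c)) := by
  obtain ⟨a, ha, hpos⟩ := hpos
  have h := hF.isSolutionOn
  have hrhoa : 0 < F.rhoM a :=
    (h.rhoM_nonneg a ha).lt_of_ne fun h0 => by simp [← h0] at hpos
  have hphia : 0 < F.rhoPhi n lam a := pos_of_mul_pos_left hpos hrhoa.le
  have hsub : ∀ t ∈ I, Set.Ici t ⊆ I := fun t ht =>
    hF.Ici_subset hn hlam hgam_pos ha hrhoa ht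
  have haI := hsub a ha
  have hrho : ∀ t ≥ a, 0 < F.rhoM t := fun t ht =>
    lt_of_lt_of_le (by positivity) (h.rhoM_lower_bound hgam_pos ha (haI ht) ht)
  have hphi : ∀ t ≥ a, 0 < F.rhoPhi n lam t := fun t ht =>
    lt_of_lt_of_le (by positivity) (h.rhoPhi_lower_bound hn hgam_pos ha (haI ht) ht)
  exact ⟨hsub,
    fun hgt => h.tendsto_ratio_atTop hn hlam hgam_pos hgam_lt haI hphi hrho (sub_pos.1 hgt),
    fun hlt => h.tendsto_ratio_zero hn hlam hgam_pos hgam_lt haI hphi hrho (sub_neg.1 hlt),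
    fun heq => h.exists_tendsto_ratio hn hlam hgam_pos hgam_lt haI hphi hrho (sub_eq_zero.1 heq)⟩
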